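/- Let $m\ge n\ge 0$ be integers. A \emph{columnwise} algorithm for the factor $R$ in the QR factorization of real $m\times n$ matrices $A$ consists, for each $j=0,\dots,n-1$, of a finite branch-free DAG that computes the entries $r_{1,j+1},\dots,r_{j,j+1}$ of column $j+1$ of $R$ lying above the diagonal. This DAG has $m$ input nodes labelled by the entries $a_{1,j+1},\dots,a_{m,j+1}$ of column $j+1$ of $A$, finitely many input nodes labelled by parameters, whose values are arbitrary functions of the columns $1,\dots,j$ of $A$ only, computation nodes, each of which adds or multiplies the outputs of two nodes, and $j$ output nodes. Viewing the output of a node as a polynomial in $a_{1,j+1},\dots,a_{m,j+1}$ whose coefficients are polynomials in the parameters, the output of every computation node is required to be homogeneous and linear in $a_{1,j+1},\dots,a_{m,j+1}$. The number of multiplications used for column $j+1$ is the number of multiplication nodes of its DAG, and the number used for several columns is the sum of these numbers. Suppose that such an algorithm does QR factorization: for every real $m\times n$ matrix $A$ of full column rank there are a real $m\times n$ matrix $Q$ with $Q^TQ=I$ and an upper triangular $R$ with $A=QR$ (no signs being prescribed on the diagonal of $R$), such that the values output by the DAGs are the entries of $R$ above the diagonal. Then (i) for every $0\le j\le n-1$,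 the algorithm uses at least $mj-\frac{j(j+1)}{2}$ multiplications to compute column $j+1$ of $R$; (ii) if $n$ is even, the algorithm uses at least $\frac{mn^2}{4}-\frac{n^2}{8}\left(\frac n2+1\right)$ multiplications in total to compute the columns $\frac n2+1,\dots,n$ of $R$. -/

import Mathlib

namespace ColumnwiseQR

/-- A node that may be read by another node of a DAG with `m` input nodes labelled by the entries
of the new column, `p` input nodes labelled by the parameters, and `k` computation nodes. -/
inductive Source (m p k : ℕ) where
  | entry (i : Fin m) : Source m p k
  | param (l : Fin p) : Source m p k
  | comp (u : Fin k) : Source m p k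

/-- A computation node: the sum or the product of the outputs of two nodes. -/
inductive Gate (m p k : ℕ) where
  | add (s t : Source m p k) : Gate m p k
  | mul (s t : Source m p k) : Gate m p k

/-- Polynomials in the `m` entries of the new column, whose coefficients are real polynomials in
the `p` parameters. -/
abbrev Poly (m p : ℕ) : Type := MvPolynomial (Fin m) (MvPolynomial (Fin p) ℝ)

/-- The polynomial output by a source, given those output by the computation nodes. -/
noncomputable def Source.poly {m p k : ℕ} (f : Fin k → Poly m p) : Source m p k → Poly m p
  | .entry i => MvPolynomial.X i
  | .param l => MvPolynomial.C (MvPolynomial.X l)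
  | .comp u => f u

/-- The polynomial output by a computation node, given those output by the earlier ones. -/
noncomputable def Gate.poly {m p k : ℕ} (f : Fin k → Poly m p) : Gate m p k → Poly m p
  | .add s t => s.poly f + t.poly f
  | .mul s t => s.poly f * t.poly f

/-- Whether the computation node is a multiplication. -/
def Gate.isMul {m p k : ℕ} : Gate m p k → Bool
  | .add _ _ => false
  | .mul _ _ => true

/-- A branch-free DAG of additions and multiplications with `j` outputs. The computation nodes are
listed in a topological order: node `k` reads only input nodes and computation nodes before `k`. -/
structure DAG (m j : ℕ) where
  /-- number of input nodes labelled by parameters -/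
  numParams : ℕ
  /-- number of computation nodes -/
  size : ℕ
  /-- the computation nodes -/
  gate : (k : Fin size) → Gate m numParams (k : ℕ)
  /-- the output nodes -/
  out : Fin j → Source m numParams size

namespace DAG

/-- The polynomial output by the `k`-th computation node. -/
noncomputable def nodePoly {m j : ℕ} (D : DAG m j) (k : Fin D.size) : Poly m D.numParams :=
  (D.gate k).poly fun u => nodePoly D ⟨u, u.2.trans k.2⟩
termination_by (k : ℕ)
decreasing_by exact u.2

/-- The polynomial output by the `i`-th output node. -/
noncomputable def outPoly {m j : ℕ} (D : DAG m j) (i : Fin j) : Poly m D.numParams :=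
  (D.out i).poly D.nodePoly

/-- The value of the `i`-th output when the parameters have the values `q` and the new column
is `a`. -/
noncomputable def outValue {m j : ℕ} (D : DAG m j) (q : Fin D.numParams → ℝ) (a : Fin m → ℝ)
    (i : Fin j) : ℝ :=
  MvPolynomial.eval₂ (MvPolynomial.eval q) a (D.outPoly i)

/-- The number of multiplication nodes. -/
def numMul {m j : ℕ} (D : DAG m j) : ℕ :=
  (Finset.univ.filter fun k : Fin D.size => (D.gate k).isMul = true).card

end DAG

/-- A columnwise (left-looking) algorithm for the entries above the diagonal of the factor `R` of
`m`-by-`n` matrices. With indices starting at `0`, column `j` of `R` has the entries in rows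
`0, …, j - 1` above the diagonal. They are computed by a DAG, from the entries of column `j` of the
matrix and from parameters that depend in any way whatsoever, but only, on the columns before
column `j`. -/
structure Algorithm (m n : ℕ) where
  /-- the operations that compute column `j` -/
  dag : (j : Fin n) → DAG m (j : ℕ)
  /-- each operation outputs a homogeneous linear polynomial in the entries of column `j` -/
  homogeneous : ∀ (j : Fin n) (k : Fin (dag j).size), ((dag j).nodePoly k).IsHomogeneous 1
  /-- the values of the parameters, as functions of the first `j` columns -/
  param : (j : Fin n) → Matrix (Fin m) (Fin (j : ℕ)) ℝ → Fin (dag j).numParams → ℝ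

/-- The first `j` columns of `A`. -/
def leadingColumns {m n : ℕ} (A : Matrix (Fin m) (Fin n) ℝ) (j : Fin n) :
    Matrix (Fin m) (Fin (j : ℕ)) ℝ :=
  A.submatrix id (Fin.castLE j.2.le)

/-- `A = Q R` is a (thin) QR factorization: `Q` has orthonormal columns and `R` is upper triangular.
No sign is prescribed for the diagonal of `R`. -/
def IsQR {m n : ℕ} (A Q : Matrix (Fin m) (Fin n) ℝ) (R : Matrix (Fin n) (Fin n) ℝ) : Prop :=
  Q.transpose * Q = 1 ∧ R.BlockTriangular id ∧ A = Q * R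

namespace Algorithm

/-- The value that the algorithm, run on `A`, computes for the entry of `R` in row `i` and
column `j`, where `i < j`. -/
noncomputable def output {m n : ℕ} (alg : Algorithm m n) (A : Matrix (Fin m) (Fin n) ℝ)
    (j : Fin n) (i : Fin (j : ℕ)) : ℝ :=
  (alg.dag j).outValue (alg.param j (leadingColumns A j)) (fun r => A r j) i

/-- The algorithm does QR factorization: run on a matrix of full column rank, it computes the
entries above the diagonal of the factor `R` of some QR factorization of that matrix. -/
def ComputesQR {m n : ℕ} (alg : Algorithm m n) : Prop :=
  ∀ A : Matrix (Fin m) (Fin n) ℝ, LinearIndependent ℝ A.col →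
    ∃ (Q : Matrix (Fin m) (Fin n) ℝ) (R : Matrix (Fin n) (Fin n) ℝ), IsQR A Q R ∧
      ∀ (j : Fin n) (i : Fin (j : ℕ)), R (Fin.castLE j.2.le i) j = alg.output A j i

/-- The number of multiplications that compute column `j` of `R`. -/
def numMul {m n : ℕ} (alg : Algorithm m n) (j : Fin n) : ℕ := (alg.dag j).numMul

end Algorithm

end ColumnwiseQR

/-!
For a fixed column `j`, homogeneity forces every multiplication with a nonzero output to multiply a
linear form in the new column by a parameter. Hence the output forms are polynomial functions of as
many real numbers as there are multiplication nodes (`Gate.eval_poly`, `DAG.outValue_eq`), and in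
particular smooth ones (`DAG.contDiff_outCoeff`).

On the other hand, let `v` be any linearly independent family of `j` vectors, taken as the first `j`
columns. The outputs are inner products of the new column with the columns of a factor `Q` of `v`.
Such a `Q` is unique up to the signs of its columns (`IsQR.eq_or_eq_neg`). The signs may vary with
the new column, but the squares of the outputs do not see them, and two linear forms with equal
squares agree up to sign. So the output forms are, up to sign, the columns of `Q`, and `v` is
recovered from them by an upper triangular matrix (`Algorithm.exists_eq_sum_outCoeff`).

Altogether, the numbers used by the multiplications together with the `j (j + 1) / 2` entries of a
triangular matrix parametrize smoothly all linearly independent families of `j` vectors in `ℝ ^ m`,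
a nonempty open subset of a space of dimension `m j`. A smooth map does not raise the Hausdorff
dimension, so the number of multiplications is at least `m j - j (j + 1) / 2`
(`Algorithm.mul_le_numMul_add`). This bound does not decrease as `j` grows, and the bound for the last
`n / 2` columns is `n / 2` times the one for column `n / 2`.
-/

namespace ColumnwiseQR

/-! ### The linear forms computed by a DAG -/

/-- The coefficient vector of the linear part of the output of a source, given those of the
computation nodes. A parameter has no linear part. -/
def Source.coeff {m p k : ℕ} (w : Fin k → Fin m → ℝ) : Source m p k → Fin m → ℝ
  | .entry i => Pi.single i 1
  | .param _ => 0
  | .comp u => w u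

/-- The constant part of the output of a source: only a parameter has one. -/
def Source.const {m p k : ℕ} (q : Fin p → ℝ) : Source m p k → ℝ
  | .entry _ => 0
  | .param l => q l
  | .comp _ => 0

/-- The coefficient vector computed by a gate when a multiplication is by the number `c`. In a
product `s * t` that is linear and nonzero, one of `s` and `t` is a parameter, hence contributes the
vector `0`; this is why the sum of the two vectors stands for that of the other factor. -/
def Gate.coeff {m p k : ℕ} (c : ℝ) (w : Fin k → Fin m → ℝ) : Gate m p k → Fin m → ℝ
  | .add s t => s.coeff w + t.coeff w
  | .mul s t => c • (s.coeff w + t.coeff w)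

/-- The number by which a gate multiplies: the value of the parameter that it reads, and `0` if the
gate is an addition or reads no parameter. -/
def Gate.scalar {m p k : ℕ} (q : Fin p → ℝ) : Gate m p k → ℝ
  | .mul (.param l) _ => q l
  | .mul _ (.param l) => q l
  | _ => 0

namespace DAG

variable {m j : ℕ}

/-- The coefficient vector of the linear form computed by the `k`-th computation node, as a function
of the numbers `c` by which the multiplication nodes multiply. -/
noncomputable def nodeCoeff (D : DAG m j) (c : Fin D.size → ℝ) (k : Fin D.size) : Fin m → ℝ :=
  (D.gate k).coeff (c k) fun u => nodeCoeff D c ⟨u, u.2.trans k.2⟩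
termination_by (k : ℕ)
decreasing_by exact u.2

/-- The numbers by which all nodes multiply, given those of the multiplication nodes. -/
def extendScalars (D : DAG m j) (c : {k // (D.gate k).isMul = true} → ℝ) (k : Fin D.size) : ℝ :=
  if h : (D.gate k).isMul = true then c ⟨k, h⟩ else 0

/-- The coefficient vector of the linear form computed by the `i`-th output, as a function of the
numbers by which the multiplication nodes multiply. -/
noncomputable def outCoeff (D : DAG m j) (c : {k // (D.gate k).isMul = true} → ℝ) (i : Fin j) :
    Fin m → ℝ :=
  (D.out i).coeff (D.nodeCoeff (D.extendScalars c))

theorem contDiff_nodeCoeff (D : DAG m j) (k : Fin D.size) :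
    ContDiff ℝ 1 fun c => D.nodeCoeff (D.extendScalars c) k := by
  have hsource : ∀ {k : Fin D.size} (s : Source m D.numParams k)
      (_ : ∀ u : Fin k, ContDiff ℝ 1 fun c =>
        D.nodeCoeff (D.extendScalars c) ⟨u, u.2.trans k.2⟩),
      ContDiff ℝ 1 fun c => s.coeff fun u : Fin k =>
        D.nodeCoeff (D.extendScalars c) ⟨u, u.2.trans k.2⟩ := by
    intro k s h
    cases s with
    | entry i => exact contDiff_const
    | param l => exact contDiff_const
    | comp u => exact h u
  obtain ⟨k, hk⟩ := k
  induction k using Nat.strong_induction_on with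
  | _ k ih =>
    have h := fun u : Fin k => ih u u.2 (u.2.trans hk)
    conv => enter [3, c]; rw [nodeCoeff]
    generalize D.gate ⟨k, hk⟩ = g
    cases g with
    | add s t => exact (hsource (k := ⟨k, hk⟩) s h).add (hsource (k := ⟨k, hk⟩) t h)
    | mul s t =>
      have hc : ContDiff ℝ 1 fun c => D.extendScalars c ⟨k, hk⟩ := by
        unfold extendScalars
        split
        · exact contDiff_apply _ _ _
        · exact contDiff_const
      exact hc.smul ((hsource (k := ⟨k, hk⟩) s h).add (hsource (k := ⟨k, hk⟩) t h))

theorem contDiff_outCoeff (D : DAG m j) (i : Fin j) : ContDiff ℝ 1 fun c => D.outCoeff c i := by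
  unfold outCoeff
  generalize D.out i = s
  cases s with
  | entry i => exact contDiff_const
  | param l => exact contDiff_const
  | comp u => exact D.contDiff_nodeCoeff u

end DAG

open MvPolynomial in
theorem eval₂_smul_of_isHomogeneous_one {σ S : Type*} [CommSemiring S] {P : MvPolynomial σ S}
    (hP : P.IsHomogeneous 1) (f : S →+* ℝ) (x : ℝ) (a : σ → ℝ) :
    P.eval₂ f (x • a) = x * P.eval₂ f a := by
  rw [eval₂_eq, eval₂_eq, Finset.mul_sum]
  refine Finset.sum_congr rfl fun d hd => ?_
  have h1 : ∑ i ∈ d.support, d i = 1 := by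
    simpa [Finsupp.weight_apply, Finsupp.sum] using hP (mem_support_iff.1 hd)
  simp only [Pi.smul_apply, smul_eq_mul, mul_pow, Finset.prod_mul_distrib, Finset.prod_pow_eq_pow_sum,
    h1]
  ring

/-- A source is an affine form in the entries if the computation nodes are linear forms. -/
theorem Source.eval_poly {m p k : ℕ} (s : Source m p k) (f : Fin k → Poly m p)
    (w : Fin k → Fin m → ℝ) (q : Fin p → ℝ) (a : Fin m → ℝ)
    (h : ∀ u, (f u).eval₂ (MvPolynomial.eval q) a = w u ⬝ᵥ a) :
    (s.poly f).eval₂ (MvPolynomial.eval q) a = s.coeff w ⬝ᵥ a + s.const q := by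
  cases s <;> simp [Source.poly, Source.coeff, Source.const, h]

/-- Where a gate outputs a homogeneous linear polynomial, it adds two linear forms or multiplies one
linear form by one parameter, up to products and sums whose value is `0`. -/
theorem Gate.eval_poly {m p k : ℕ} (g : Gate m p k) (f : Fin k → Poly m p)
    (w : Fin k → Fin m → ℝ) (q : Fin p → ℝ) (hg : (g.poly f).IsHomogeneous 1)
    (h : ∀ u a, (f u).eval₂ (MvPolynomial.eval q) a = w u ⬝ᵥ a) (a : Fin m → ℝ) :
    (g.poly f).eval₂ (MvPolynomial.eval q) a = g.coeff (g.scalar q) w ⬝ᵥ a := by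
  have h0 := eval₂_smul_of_isHomogeneous_one hg (MvPolynomial.eval q) 0 a
  have h2 := eval₂_smul_of_isHomogeneous_one hg (MvPolynomial.eval q) 2 a
  cases g with
  | add s t =>
    simp only [Gate.poly, MvPolynomial.eval₂_add, fun a => s.eval_poly f w q a (h · a),
      fun a => t.eval_poly f w q a (h · a), zero_smul, dotProduct_zero, Gate.coeff,
      add_dotProduct] at h0 ⊢
    linarith
  | mul s t =>
    have hscalar : (Gate.mul s t).scalar q • (s.coeff w + t.coeff w) =
        s.const q • t.coeff w + t.const q • s.coeff w := by
      cases s <;> cases t <;> simp [Gate.scalar, Source.coeff, Source.const]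
    simp only [Gate.poly, MvPolynomial.eval₂_mul, fun a => s.eval_poly f w q a (h · a),
      fun a => t.eval_poly f w q a (h · a), zero_smul, dotProduct_zero, dotProduct_smul,
      smul_eq_mul, Gate.coeff, hscalar, add_dotProduct, smul_dotProduct] at h0 h2 ⊢
    -- `h0` kills the product of the constants, and comparison with `h2` the quadratic part
    linarith

namespace DAG

variable {m j : ℕ}

/-- The numbers by which the multiplication nodes multiply when the parameters have the values
`q`. -/
def scalars (D : DAG m j) (q : Fin D.numParams → ℝ) (k : {k // (D.gate k).isMul = true}) : ℝ :=
  (D.gate k).scalar q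

theorem extendScalars_scalars (D : DAG m j) (q : Fin D.numParams → ℝ) (k : Fin D.size) :
    D.extendScalars (D.scalars q) k = (D.gate k).scalar q := by
  unfold extendScalars scalars
  split
  · rfl
  · next h =>
    generalize D.gate k = g at h
    cases g <;> simp_all [Gate.isMul, Gate.scalar]

theorem eval_nodePoly (D : DAG m j) (hD : ∀ k, (D.nodePoly k).IsHomogeneous 1)
    (q : Fin D.numParams → ℝ) (k : Fin D.size) (a : Fin m → ℝ) :
    (D.nodePoly k).eval₂ (MvPolynomial.eval q) a =
      D.nodeCoeff (D.extendScalars (D.scalars q)) k ⬝ᵥ a := by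
  obtain ⟨k, hk⟩ := k
  induction k using Nat.strong_induction_on generalizing a with
  | _ k ih =>
    have hg := hD ⟨k, hk⟩
    rw [nodePoly] at hg ⊢
    rw [nodeCoeff, extendScalars_scalars]
    exact Gate.eval_poly _ _ _ _ hg (fun u a => ih u u.2 a (u.2.trans hk)) a

theorem outValue_eq (D : DAG m j) (hD : ∀ k, (D.nodePoly k).IsHomogeneous 1)
    (q : Fin D.numParams → ℝ) (a : Fin m → ℝ) (i : Fin j) :
    D.outValue q a i = D.outCoeff (D.scalars q) i ⬝ᵥ a + (D.out i).const q :=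
  Source.eval_poly _ _ _ _ _ fun u => D.eval_nodePoly hD q u a

end DAG

/-! ### Uniqueness of the QR factorization -/

theorem isUnit_of_linearIndependent_mul {m j : ℕ} {Q : Matrix (Fin m) (Fin j) ℝ}
    {R : Matrix (Fin j) (Fin j) ℝ} (h : LinearIndependent ℝ (Q * R).col) : IsUnit R := by
  rw [← Matrix.mulVec_injective_iff_isUnit]
  rw [← Matrix.mulVec_injective_iff] at h
  intro x y hxy
  apply h
  simp only [← Matrix.mulVec_mulVec, hxy]

/-- The factor `Q` of a matrix of full column rank is unique up to the signs of its columns: the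
transition matrix between two such factors is orthogonal and upper triangular, hence diagonal. -/
theorem IsQR.eq_or_eq_neg {m j : ℕ} {A Q Q' : Matrix (Fin m) (Fin j) ℝ}
    {R R' : Matrix (Fin j) (Fin j) ℝ} (hA : LinearIndependent ℝ A.col) (h : IsQR A Q R)
    (h' : IsQR A Q' R') (i : Fin j) : Q'.col i = Q.col i ∨ Q'.col i = -Q.col i := by
  obtain ⟨hQ, hR, hAR⟩ := h
  obtain ⟨hQ', hR', hAR'⟩ := h'
  have hu' : IsUnit R' := isUnit_of_linearIndependent_mul (hAR' ▸ hA)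
  let := hu'.invertible
  have hR'inv : R'⁻¹.BlockTriangular id := Matrix.blockTriangular_inv_of_blockTriangular hR'
  obtain ⟨U, hU⟩ : ∃ U, U = R * R'⁻¹ := ⟨_, rfl⟩
  have hUt : U.BlockTriangular id := hU ▸ hR.mul hR'inv
  have hQU : Q' = Q * U := by
    rw [hU, ← Matrix.mul_assoc, ← hAR, hAR', Matrix.mul_assoc, Matrix.mul_inv_of_invertible,
      Matrix.mul_one]
  have hUU : U.transpose * U = 1 := by
    rw [hQU, Matrix.transpose_mul, Matrix.mul_assoc, ← Matrix.mul_assoc _ Q, hQ,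
      Matrix.one_mul] at hQ'
    exact hQ'
  let : Invertible U := ⟨U.transpose, hUU, mul_eq_one_comm.1 hUU⟩
  have hinv : U⁻¹ = U.transpose := Matrix.inv_eq_left_inv hUU
  have hUt' : U.transpose.BlockTriangular id :=
    hinv ▸ Matrix.blockTriangular_inv_of_blockTriangular hUt
  have hdiag : ∀ a b, a ≠ b → U a b = 0 := fun a b hab =>
    hab.lt_or_gt.elim (fun hlt => hUt' hlt) (fun hlt => hUt hlt)
  have hsq : U i i * U i i = 1 := by
    have := congrFun (congrFun hUU i) i
    rwa [Matrix.mul_apply, Finset.sum_eq_single i (fun b _ hb => by simp [hdiag b i hb])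
      (by simp), Matrix.transpose_apply, Matrix.one_apply_eq] at this
  have hcol : Q'.col i = U i i • Q.col i := by
    ext r
    rw [hQU, Matrix.col_apply, Matrix.mul_apply,
      Finset.sum_eq_single i (fun b _ hb => by simp [hdiag b i hb]) (by simp)]
    simp [mul_comm]
  rcases mul_self_eq_one_iff.1 hsq with h1 | h1 <;> simp [hcol, h1]

/-- The leading columns of a QR factorization form a QR factorization. -/
theorem IsQR.leadingColumns {m n : ℕ} {A Q : Matrix (Fin m) (Fin n) ℝ}
    {R : Matrix (Fin n) (Fin n) ℝ} (h : IsQR A Q R) (j : Fin n) :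
    IsQR (leadingColumns A j) (leadingColumns Q j)
      (R.submatrix (Fin.castLE j.2.le) (Fin.castLE j.2.le)) := by
  obtain ⟨hQ, hR, rfl⟩ := h
  refine ⟨?_, fun a b hab => hR hab, ?_⟩
  · ext a b
    have := congrFun (congrFun hQ (Fin.castLE j.2.le a)) (Fin.castLE j.2.le b)
    simpa [ColumnwiseQR.leadingColumns, Matrix.mul_apply, Matrix.one_apply] using this
  · ext r b
    simp only [ColumnwiseQR.leadingColumns, Matrix.submatrix_apply, Matrix.mul_apply, id]
    symm
    refine Fintype.sum_of_injective (Fin.castLE j.2.le) (Fin.castLE_injective _) _ _ ?_ ?_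
    · intro l hl
      have hlj : (j : ℕ) ≤ l := by
        by_contra! hlt
        exact hl ⟨⟨l, hlt⟩, rfl⟩
      rw [hR (show id (Fin.castLE j.2.le b) < id l from lt_of_lt_of_le b.2 hlj), mul_zero]
    · intro l
      rfl

theorem IsQR.apply_eq_dotProduct {m n : ℕ} {A Q : Matrix (Fin m) (Fin n) ℝ}
    {R : Matrix (Fin n) (Fin n) ℝ} (h : IsQR A Q R) (i j : Fin n) :
    R i j = Q.col i ⬝ᵥ A.col j := by
  have : R = Q.transpose * A := by rw [h.2.2, ← Matrix.mul_assoc, h.1, Matrix.one_mul]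
  rw [this]
  rfl

/-! ### Linear algebra -/

theorem exists_linearIndependent_extension {K E : Type*} [DivisionRing K] [AddCommGroup E]
    [Module K E] [Module.Finite K E] {l n : ℕ} (hln : l ≤ n) (hn : n ≤ Module.finrank K E)
    {v : Fin l → E} (hv : LinearIndependent K v) :
    ∃ w : Fin n → E, LinearIndependent K w ∧ ∀ i, w (Fin.castLE hln i) = v i := by
  induction n, hln using Nat.le_induction with
  | base => exact ⟨v, hv, fun i => rfl⟩
  | succ n hln ih =>
    obtain ⟨w, hw, hwv⟩ := ih (Nat.le_of_succ_le hn)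
    obtain ⟨x, hx⟩ := exists_linearIndependent_snoc_of_lt_finrank hw hn
    refine ⟨Fin.snoc w x, hx, fun i => ?_⟩
    rw [← hwv i, ← Fin.castSucc_castLE, Fin.snoc_castSucc]

/-- Two linear forms with the same square agree up to sign. -/
theorem eq_or_eq_neg_of_dotProduct_sq_eq {m : ℕ} {f g : Fin m → ℝ}
    (h : ∀ a, (f ⬝ᵥ a) ^ 2 = (g ⬝ᵥ a) ^ 2) : f = g ∨ f = -g := by
  by_contra! hne
  have h1 : ∃ a, f ⬝ᵥ a ≠ g ⬝ᵥ a := by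
    by_contra! hc
    exact hne.1 (dotProduct_eq _ _ hc)
  have h2 : ∃ b, f ⬝ᵥ b ≠ -(g ⬝ᵥ b) := by
    by_contra! hc
    exact hne.2 (dotProduct_eq _ _ fun b => by rw [hc b, neg_dotProduct])
  obtain ⟨a, ha⟩ := h1
  obtain ⟨b, hb⟩ := h2
  have ha' := (sq_eq_sq_iff_eq_or_eq_neg.1 (h a)).resolve_left ha
  have hb' := (sq_eq_sq_iff_eq_or_eq_neg.1 (h b)).resolve_right hb
  have hab := sq_eq_sq_iff_eq_or_eq_neg.1 (h (a + b))
  rw [dotProduct_add, dotProduct_add, ha', hb'] at hab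
  rcases hab with hab | hab
  · exact ha (by linarith)
  · exact hb (by linarith)

theorem dense_compl_span_range {m j : ℕ} (hjm : j < m) (v : Fin j → Fin m → ℝ) :
    Dense ((Submodule.span ℝ (Set.range v) : Set (Fin m → ℝ))ᶜ) := by
  rw [← interior_eq_empty_iff_dense_compl, ← Set.not_nonempty_iff_eq_empty]
  intro hne
  have htop := Submodule.eq_top_of_nonempty_interior' _ hne
  have h1 := finrank_range_le_card (R := ℝ) v
  rw [Set.finrank, htop, finrank_top, Module.finrank_fin_fun, Fintype.card_fin] at h1
  omega

/-! ### The dimension count -/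

namespace Algorithm

variable {m n : ℕ}

/-- When the first `j` columns are `v` and the next column `a` is not in their span, the outputs for
column `j` are the inner products of `a` with the columns of some factor `Q` of `v`. -/
theorem exists_isQR_outValue (hmn : n ≤ m) (alg : Algorithm m n) (halg : alg.ComputesQR) (j : Fin n)
    {v : Fin j → Fin m → ℝ} (hv : LinearIndependent ℝ v) {a : Fin m → ℝ}
    (ha : a ∉ Submodule.span ℝ (Set.range v)) :
    ∃ Q R, IsQR (Matrix.of v).transpose Q R ∧
      ∀ i, (alg.dag j).outValue (alg.param j (Matrix.of v).transpose) a i = Q.col i ⬝ᵥ a := by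
  obtain ⟨w, hw, hwv⟩ := exists_linearIndependent_extension (n := n) (l := j + 1) j.2 (by simpa)
    (linearIndependent_finSnoc.2 ⟨hv, ha⟩)
  obtain ⟨Q, R, hQR, hout⟩ := halg (Matrix.of w).transpose hw
  have hlead : ColumnwiseQR.leadingColumns (Matrix.of w).transpose j = (Matrix.of v).transpose := by
    ext r i
    have := hwv i.castSucc
    rw [Fin.snoc_castSucc] at this
    exact congrFun this r
  have hlast : w j = a := by
    have := hwv (Fin.last j)
    rwa [Fin.snoc_last] at this
  refine ⟨_, _, hlead ▸ hQR.leadingColumns j, fun i => ?_⟩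
  have := hout j i
  rw [hQR.apply_eq_dotProduct, output, hlead] at this
  change Q.col _ ⬝ᵥ w j = (alg.dag j).outValue _ (w j) i at this
  rw [hlast] at this
  exact this.symm

/-- The coefficient vectors of the outputs are, up to sign, the columns of the factor `Q` of the
first `j` columns `v`, so that `v` is recovered from them by an upper triangular matrix. -/
theorem exists_eq_sum_outCoeff (hmn : n ≤ m) (alg : Algorithm m n) (halg : alg.ComputesQR)
    (j : Fin n) {v : Fin j → Fin m → ℝ} (hv : LinearIndependent ℝ v) :
    ∃ (c : {k // ((alg.dag j).gate k).isMul = true} → ℝ) (T : Matrix (Fin j) (Fin j) ℝ),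
      T.BlockTriangular id ∧ ∀ k, v k = ∑ i, T i k • (alg.dag j).outCoeff c i := by
  set D := alg.dag j
  set q : Fin D.numParams → ℝ := alg.param j (Matrix.of v).transpose with hq
  have hdense := dense_compl_span_range (j.2.trans_le hmn) v
  obtain ⟨a₀, ha₀⟩ : ∃ a₀, a₀ ∉ Submodule.span ℝ (Set.range v) := hdense.nonempty
  obtain ⟨Q, R, hQR, -⟩ := alg.exists_isQR_outValue hmn halg j hv ha₀
  have hsq (i : Fin j) (a : Fin m → ℝ) :
      (D.outCoeff (D.scalars q) i ⬝ᵥ a + (D.out i).const q) ^ 2 = (Q.col i ⬝ᵥ a) ^ 2 := by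
    -- `Q` may change with `a`, but only by signs, which the square forgets
    refine congrFun (Continuous.ext_on hdense
      (f := fun a => (D.outCoeff (D.scalars q) i ⬝ᵥ a + (D.out i).const q) ^ 2)
      (g := fun a => (Q.col i ⬝ᵥ a) ^ 2) (by fun_prop) (by fun_prop) fun a ha => ?_) a
    obtain ⟨Q', R', hQR', hout⟩ := alg.exists_isQR_outValue hmn halg j hv ha
    have hval := hout i
    rw [← hq, D.outValue_eq (alg.homogeneous j)] at hval
    change (_ + _) ^ 2 = (Q.col i ⬝ᵥ a) ^ 2
    rw [hval]
    rcases hQR.eq_or_eq_neg hv hQR' i with h | h <;> simp [h]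
  have hconst (i : Fin j) : (D.out i).const q = 0 := by simpa using hsq i 0
  have hsign (i : Fin j) : ∃ ε : ℝ, Q.col i = ε • D.outCoeff (D.scalars q) i := by
    rcases eq_or_eq_neg_of_dotProduct_sq_eq (f := D.outCoeff (D.scalars q) i) (g := Q.col i)
      (fun a => by simpa [hconst i] using hsq i a) with h | h
    · exact ⟨1, by simp [h]⟩
    · exact ⟨-1, by simp [h]⟩
  choose ε hε using hsign
  refine ⟨D.scalars q, Matrix.of fun i k => R i k * ε i, fun a b hab => ?_, fun k => ?_⟩
  · simp [hQR.2.1 hab]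
  · ext r
    have h1 := congrFun (congrFun hQR.2.2 r) k
    rw [Matrix.transpose_apply, Matrix.of_apply, Matrix.mul_apply] at h1
    rw [h1, Finset.sum_apply]
    refine Finset.sum_congr rfl fun i _ => ?_
    have h2 := congrFun (hε i) r
    rw [Matrix.col_apply] at h2
    rw [h2]
    simp only [Pi.smul_apply, smul_eq_mul, Matrix.of_apply]
    ring

/-- The matrix whose columns are combined from the output forms by an upper triangular matrix, as a
function of the scalars of the multiplication nodes and of the entries of the triangular matrix.
The entry in row `i` and column `k` of the latter is stored at `⟨k, i⟩`. -/
noncomputable def reconstruct (alg : Algorithm m n) (j : Fin n)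
    (x : ({k // ((alg.dag j).gate k).isMul = true} → ℝ) × ((Σ k : Fin j, Fin (k + 1)) → ℝ)) :
    Fin j → Fin m → ℝ :=
  fun k => ∑ i : Fin j,
    (if h : (i : ℕ) < k + 1 then x.2 ⟨k, i, h⟩ else 0) • (alg.dag j).outCoeff x.1 i

theorem contDiff_reconstruct (alg : Algorithm m n) (j : Fin n) :
    ContDiff ℝ 1 (alg.reconstruct j) := by
  refine contDiff_pi.2 fun k => ContDiff.sum fun i _ => ContDiff.fun_smul ?_
    (((alg.dag j).contDiff_outCoeff i).comp contDiff_fst)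
  split
  · exact (contDiff_apply ℝ ℝ _).comp contDiff_snd
  · exact contDiff_const

theorem mem_range_reconstruct (hmn : n ≤ m) (alg : Algorithm m n) (halg : alg.ComputesQR)
    (j : Fin n) {v : Fin j → Fin m → ℝ} (hv : LinearIndependent ℝ v) :
    v ∈ Set.range (alg.reconstruct j) := by
  obtain ⟨c, T, hT, h⟩ := alg.exists_eq_sum_outCoeff hmn halg j hv
  refine ⟨(c, fun p => T (Fin.castLE p.1.2 p.2) p.1), funext fun k => ?_⟩
  rw [h k]
  refine Finset.sum_congr rfl fun i _ => ?_
  split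
  · rfl
  · rw [hT (show id k < id i from by simp only [id, Fin.lt_def]; omega)]

/-- Counting dimensions: a smooth map onto the open set of matrices of full column rank needs at
least as many variables as the matrices have entries. -/
theorem mul_le_numMul_add (hmn : n ≤ m) (alg : Algorithm m n) (halg : alg.ComputesQR) (j : Fin n) :
    j * m ≤ alg.numMul j + ∑ k ∈ Finset.range j, (k + 1) := by
  have hrank : Module.finrank ℝ (({k // ((alg.dag j).gate k).isMul = true} → ℝ) ×
      ((Σ k : Fin j, Fin (k + 1)) → ℝ)) = alg.numMul j + ∑ k ∈ Finset.range j, (k + 1) := by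
    rw [Module.finrank_prod, Module.finrank_fintype_fun_eq_card,
      Module.finrank_fintype_fun_eq_card, Fintype.card_sigma, Fintype.card_subtype]
    simp only [Fintype.card_fin]
    rw [Fin.sum_univ_eq_sum_range (fun k => k + 1) j]
    rfl
  have hrank' : Module.finrank ℝ (Fin j → Fin m → ℝ) = j * m := by
    simp [Module.finrank_pi_fintype]
  rw [← hrank, ← hrank']
  by_contra! hlt
  have hdense := (alg.contDiff_reconstruct j).dense_compl_range_of_finrank_lt_finrank hlt
  obtain ⟨v, hv, -⟩ := exists_linearIndependent_extension (K := ℝ) (E := Fin m → ℝ)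
    (Nat.zero_le j) (by simpa using j.2.le.trans hmn)
    (linearIndependent_empty_type (v := (Fin.elim0 : Fin 0 → Fin m → ℝ)))
  obtain ⟨w, hw, hw'⟩ := hdense.inter_open_nonempty _ isOpen_setOfPred_linearIndependent ⟨v, hv⟩
  exact hw' (alg.mem_range_reconstruct hmn halg j hw)

theorem le_numMul (hmn : n ≤ m) (alg : Algorithm m n) (halg : alg.ComputesQR) (j : Fin n) :
    (m : ℝ) * (j : ℕ) - ((j : ℕ) : ℝ) * (((j : ℕ) : ℝ) + 1) / 2 ≤ (alg.numMul j : ℝ) := by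
  have hgauss (l : ℕ) : ((∑ k ∈ Finset.range l, (k + 1) : ℕ) : ℝ) = (l : ℝ) * (l + 1) / 2 := by
    induction l with
    | zero => simp
    | succ l ih =>
      rw [Finset.sum_range_succ, Nat.cast_add, ih]
      push_cast
      ring
  have h : ((j * m : ℕ) : ℝ) ≤ (alg.numMul j + ∑ k ∈ Finset.range j, (k + 1) : ℕ) := by
    exact_mod_cast alg.mul_le_numMul_add hmn halg j
  rw [Nat.cast_add, hgauss] at h
  push_cast at h
  linarith

end Algorithm

end ColumnwiseQR

theorem mainTheorem4 (m n : ℕ) (hmn : n ≤ m) (alg : ColumnwiseQR.Algorithm m n)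
    (halg : alg.ComputesQR) :
    (∀ j : Fin n,
      (m : ℝ) * (j : ℕ) - ((j : ℕ) : ℝ) * (((j : ℕ) : ℝ) + 1) / 2 ≤ (alg.numMul j : ℝ)) ∧
    (Even n →
      (m : ℝ) * (n : ℝ) ^ 2 / 4 - (n : ℝ) ^ 2 / 8 * ((n : ℝ) / 2 + 1) ≤
        ((∑ j ∈ Finset.univ.filter (fun j : Fin n => n / 2 ≤ (j : ℕ)), alg.numMul j : ℕ) : ℝ)) := by
  refine ⟨alg.le_numMul hmn halg, ?_⟩
  rintro ⟨h, rfl⟩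
  have hdiv : (h + h) / 2 = h := by omega
  rw [hdiv, Nat.cast_sum]
  have hcard : (Finset.univ.filter fun j : Fin (h + h) => h ≤ (j : ℕ)).card = h := by
    rw [Finset.card_filter, Fin.sum_univ_add]
    simp [Nat.not_le.2]
  -- the bound for a single column does not decrease as `j` grows, because `j < m`
  have hmono : ∀ j ∈ Finset.univ.filter (fun j : Fin (h + h) => h ≤ (j : ℕ)),
      (m : ℝ) * h - (h : ℝ) * (h + 1) / 2 ≤ (alg.numMul j : ℝ) := by
    intro j hj
    refine le_trans ?_ (alg.le_numMul hmn halg j)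
    have h1 : (h : ℝ) ≤ (j : ℕ) := by exact_mod_cast (Finset.mem_filter.1 hj).2
    have h2 : ((j : ℕ) : ℝ) + 1 ≤ m := by exact_mod_cast j.2.trans_le hmn
    nlinarith [mul_nonneg (sub_nonneg.2 h1) (sub_nonneg.2 h2)]
  have hsum := Finset.card_nsmul_le_sum _ _ _ hmono
  rw [hcard, nsmul_eq_mul] at hsum
  refine le_trans (le_of_eq ?_) hsum
  push_cast
  ring
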